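/- Let $\mathbb{K}$ be $\mathbb{R}$ or $\mathbb{C}$, and let $l^2$ be the Hilbert space of square-summable sequences $(x_i)_{i\in\mathbb{N}}$ in $\mathbb{K}$, with standard orthonormal basis $(e_i)_{i\in\mathbb{N}}$. A bounded operator $T$ on $l^2$ is of trace class if $\sum_i \langle |T| e_i, e_i\rangle < \infty$, where $|T| = (T^*T)^{1/2}$; its trace is then $\operatorname{tr} T = \sum_i \langle T e_i, e_i\rangle$. Let $\mathcal{S}$ be a set of trace-class operators on $l^2$ that is closed under multiplication (composition) and self-adjoint, i.e. $T^* \in \mathcal{S}$ for every $T \in \mathcal{S}$. Suppose that the set $\{\operatorname{tr} T : T \in \mathcal{S}\}$ is finite. If $\mathcal{S}$ contains only finitely many projections (that is, self-adjoint idempotents $P = P^* = P^2$), then $\mathcal{S}$ is finite. -/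

import Mathlib

/-- The real or complex Hilbert space `l²` of square-summable sequences. -/
abbrev L2Seq (𝕜 : Type*) [RCLike 𝕜] : Type _ := lp (fun _ : ℕ => 𝕜) 2

/-- The vector `e i` of the standard orthonormal basis of `l²`. -/
noncomputable def stdVec (𝕜 : Type*) [RCLike 𝕜] (i : ℕ) : L2Seq 𝕜 :=
  lp.single 2 i (1 : 𝕜)

/-- The `i`-th diagonal entry `⟨T e_i, e_i⟩` of the matrix of `T` in the standard basis (the inner
product of Mathlib is conjugate-linear in its first argument). -/
noncomputable def diagEntry {𝕜 : Type*} [RCLike 𝕜] (T : L2Seq 𝕜 →L[𝕜] L2Seq 𝕜) (i : ℕ) : 𝕜 :=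
  inner 𝕜 (stdVec 𝕜 i) (T (stdVec 𝕜 i))

/-- `A` is the absolute value `|T| = (T* T)^(1/2)` of `T`: the (unique) positive semidefinite
bounded operator whose square is `T* T`. On a real space `ContinuousLinearMap.IsPositive`
includes the symmetry of `A`. -/
def IsAbsOf {𝕜 : Type*} [RCLike 𝕜] (A T : L2Seq 𝕜 →L[𝕜] L2Seq 𝕜) : Prop :=
  A.IsPositive ∧ A * A = ContinuousLinearMap.adjoint T * T

/-- `T` is of trace class: the trace `∑ ⟨|T| e_i, e_i⟩` of its absolute value is finite. -/
def IsTraceClass {𝕜 : Type*} [RCLike 𝕜] (T : L2Seq 𝕜 →L[𝕜] L2Seq 𝕜) : Prop :=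
  ∃ A : L2Seq 𝕜 →L[𝕜] L2Seq 𝕜, IsAbsOf A T ∧ Summable (diagEntry A)

/-- The trace of a trace-class operator, the sum of its diagonal entries (the series converges
absolutely when `T` is of trace class). -/
noncomputable def opTrace {𝕜 : Type*} [RCLike 𝕜] (T : L2Seq 𝕜 →L[𝕜] L2Seq 𝕜) : 𝕜 :=
  ∑' i, diagEntry T i

/-! For `T` in `S`, the powers of `A = T*T` lie in `S`, and their squared Hilbert-Schmidt norms are
traces of elements of `S`, hence take finitely many values. Boundedness forces `‖A‖ ≤ 1`, and two
equal values force `A² = A`. So `T*T` and `TT*` are projections in `S`, which leaves finitely many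
pairs `(T*T, TT*)`.

Fixing such a pair fixes the norms of all columns and rows of `T`, which makes the fibre totally
bounded in the Hilbert-Schmidt norm. Squared distances `tr T*T - 2 Re tr T*V + tr V*V` take finitely
many values, so `S` is uniformly separated and each fibre is finite
(`finite_of_hsNormSq_separated`). -/

/-! ### Positive and self-adjoint operators on a Hilbert space. -/

section HilbertSpace

open ContinuousLinearMap

variable {𝕜 E : Type*} [RCLike 𝕜] [NormedAddCommGroup E] [InnerProductSpace 𝕜 E]

/-- A positive operator satisfies `‖B x‖² ≤ (‖B‖ + 1) ⟨B x, x⟩`. -/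
theorem ContinuousLinearMap.IsPositive.norm_apply_sq_le {B : E →L[𝕜] E} (hB : B.IsPositive)
    (x : E) : ‖B x‖ ^ 2 ≤ (‖B‖ + 1) * RCLike.re (inner 𝕜 (B x) x) := by
  have hs : ∀ u v, inner 𝕜 (B u) v = inner 𝕜 u (B v) := fun u v => hB.isSymmetric u v
  have hc : 0 < ‖B‖ + 1 := by positivity
  -- With `c = ‖B‖ + 1`, this expands to `c²⟨Bx,x⟩ - 2c‖Bx‖² + ⟨BBx,Bx⟩ ≥ 0`; the `+ 1` lets `c` be
  -- cancelled even if `B = 0`.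
  have h := hB.re_inner_nonneg_left (((‖B‖ + 1 : ℝ) : 𝕜) • x - B x)
  have h2 : RCLike.re (inner 𝕜 (B (B x)) (B x)) ≤ ‖B‖ * ‖B x‖ ^ 2 := by
    refine (RCLike.re_le_norm _).trans ((norm_inner_le_norm _ _).trans ?_)
    nlinarith [B.le_opNorm (B x), norm_nonneg (B x)]
  have h3 : RCLike.re (inner 𝕜 (B x) (B x)) = ‖B x‖ ^ 2 := inner_self_eq_norm_sq (𝕜 := 𝕜) (B x)
  rw [map_sub, map_smul, inner_sub_left, inner_sub_right, inner_sub_right, inner_smul_left,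
    inner_smul_left, inner_smul_right, inner_smul_right, hs (B x) x] at h
  simp only [map_sub, RCLike.conj_ofReal, RCLike.re_ofReal_mul, h3] at h
  have h4 : 0 ≤ (‖B‖ + 1) * ((‖B‖ + 1) * RCLike.re (inner 𝕜 (B x) x) - ‖B x‖ ^ 2) := by
    nlinarith [sq_nonneg ‖B x‖]
  have := nonneg_of_mul_nonneg_right h4 hc
  linarith

variable [CompleteSpace E]

theorem IsSelfAdjoint.inner_apply_left {B : E →L[𝕜] E} (hB : IsSelfAdjoint B) (u v : E) :
    inner 𝕜 (B u) v = inner 𝕜 u (B v) :=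
  (isSelfAdjoint_iff_isSymmetric.1 hB) u v

theorem IsSelfAdjoint.apply_eq_zero_of_pow {B : E →L[𝕜] E} (hB : IsSelfAdjoint B) {x : E}
    (n : ℕ) (h : (B ^ (n + 1)) x = 0) : B x = 0 := by
  induction n with
  | zero => simpa using h
  | succ k ih =>
    apply ih
    rw [← inner_self_eq_zero (𝕜 := 𝕜), (hB.pow (k + 1)).inner_apply_left]
    have : (B ^ (k + 1)) ((B ^ (k + 1)) x) = (B ^ k) ((B ^ (k + 1 + 1)) x) := by
      rw [← mul_apply_eq_comp, ← mul_apply_eq_comp, ← pow_add, ← pow_add]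
      congr 2
      omega
    rw [this, h, map_zero, inner_zero_right]

/-- A positive contraction whose powers `A ^ (n + 1)` and `A ^ (n + 2)` have the same norm on a
vector `x` fixes `A x`. -/
theorem ContinuousLinearMap.IsPositive.apply_apply_eq {A : E →L[𝕜] E} (hA : A.IsPositive)
    (hA1 : ‖A‖ ≤ 1) (n : ℕ) {x : E} (h : ‖(A ^ (n + 2)) x‖ = ‖(A ^ (n + 1)) x‖) :
    A (A x) = A x := by
  have hsa := hA.isSelfAdjoint
  set y := (A ^ (n + 1)) x with hy
  have h1 : (A ^ (n + 2)) x = A y := by rw [hy, ← mul_apply_eq_comp, ← pow_succ']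
  have hAy : ‖A y‖ = ‖y‖ := by rw [← h1, h]
  -- The square is `‖A²y‖² - 2‖Ay‖² + ‖y‖²`, with `‖A²y‖ ≤ ‖Ay‖ = ‖y‖`.
  have h2 : ‖A (A y) - y‖ ^ 2 ≤ 0 := by
    rw [@norm_sub_sq 𝕜, hsa.inner_apply_left, inner_self_eq_norm_sq (𝕜 := 𝕜), hAy]
    have h3 : ‖A (A y)‖ ≤ ‖y‖ := by
      rw [← hAy]; simpa using A.le_of_opNorm_le hA1 (A y)
    nlinarith [norm_nonneg (A (A y))]
  have h3 : A (A y) = y := by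
    have : ‖A (A y) - y‖ = 0 := by nlinarith [norm_nonneg (A (A y) - y)]
    exact sub_eq_zero.1 (norm_eq_zero.1 this)
  have h4 : (A ^ (n + 1)) (A (A x) - x) = 0 := by
    rw [map_sub, ← hy, sub_eq_zero]
    have : (A ^ (n + 1)) (A (A x)) = A (A y) := by
      rw [hy]
      simp only [← mul_apply_eq_comp, ← pow_succ', ← mul_assoc, ← pow_succ]
    rw [this, h3]
  have h5 := hsa.apply_eq_zero_of_pow n h4
  rw [map_sub] at h5
  -- Since `A³x = Ax`, `z` satisfies `Az = -z`, and positivity rules out the eigenvalue `-1`.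
  set z := A (A x) - A x with hz
  have h6 : A z = -z := by
    rw [hz, map_sub, sub_eq_zero.1 h5]; abel
  have h7 := hA.re_inner_nonneg_left z
  rw [h6, inner_neg_left, map_neg, inner_self_eq_norm_sq (𝕜 := 𝕜)] at h7
  have h8 : ‖z‖ = 0 := by nlinarith [norm_nonneg z]
  exact sub_eq_zero.1 (norm_eq_zero.1 h8)

end HilbertSpace

/-! ### Hilbert-Schmidt operators on `l²` and their traces. -/

section SequenceSpace

open ContinuousLinearMap

variable {𝕜 : Type*} [RCLike 𝕜]

theorem inner_stdVec (i : ℕ) (x : L2Seq 𝕜) : inner 𝕜 (stdVec 𝕜 i) x = x i := by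
  simp [stdVec, lp.inner_single_left]

theorem norm_stdVec (i : ℕ) : ‖stdVec 𝕜 i‖ = 1 := by
  simp [stdVec, lp.norm_single]

theorem L2Seq.hasSum_norm_sq (x : L2Seq 𝕜) : HasSum (fun i => ‖x i‖ ^ 2) (‖x‖ ^ 2) := by
  simpa using lp.hasSum_norm (p := 2) (by norm_num) x

/-- `T` is a Hilbert-Schmidt operator. -/
def IsHilbertSchmidt (T : L2Seq 𝕜 →L[𝕜] L2Seq 𝕜) : Prop :=
  Summable fun i => ‖T (stdVec 𝕜 i)‖ ^ 2

/-- The square of the Hilbert-Schmidt norm. -/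
noncomputable def hsNormSq (T : L2Seq 𝕜 →L[𝕜] L2Seq 𝕜) : ℝ :=
  ∑' i, ‖T (stdVec 𝕜 i)‖ ^ 2

theorem hsNormSq_nonneg (T : L2Seq 𝕜 →L[𝕜] L2Seq 𝕜) : 0 ≤ hsNormSq T :=
  tsum_nonneg fun _ => sq_nonneg _

theorem coord_adjoint (T : L2Seq 𝕜 →L[𝕜] L2Seq 𝕜) (i : ℕ) (x : L2Seq 𝕜) :
    T x i = inner 𝕜 (adjoint T (stdVec 𝕜 i)) x := by
  rw [adjoint_inner_left, inner_stdVec]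

theorem norm_coord_le (T : L2Seq 𝕜 →L[𝕜] L2Seq 𝕜) (i : ℕ) (x : L2Seq 𝕜) :
    ‖T x i‖ ≤ ‖adjoint T (stdVec 𝕜 i)‖ * ‖x‖ := by
  rw [coord_adjoint]
  exact norm_inner_le_norm _ _

/-- The coordinates of `T*x` are the inner products `⟨T e_i, x⟩`, so Cauchy-Schwarz applies to each.
-/
theorem IsHilbertSchmidt.norm_adjoint_apply_sq_le {T : L2Seq 𝕜 →L[𝕜] L2Seq 𝕜}
    (hT : IsHilbertSchmidt T) (x : L2Seq 𝕜) : ‖adjoint T x‖ ^ 2 ≤ hsNormSq T * ‖x‖ ^ 2 := by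
  rw [← (L2Seq.hasSum_norm_sq (adjoint T x)).tsum_eq, hsNormSq, ← tsum_mul_right]
  refine Summable.tsum_le_tsum (fun i => ?_) (L2Seq.hasSum_norm_sq _).summable (hT.mul_right _)
  rw [← mul_pow]
  simpa using pow_le_pow_left₀ (norm_nonneg _) (norm_coord_le (adjoint T) i x) 2

theorem IsHilbertSchmidt.norm_sq_le {T : L2Seq 𝕜 →L[𝕜] L2Seq 𝕜}
    (hT : IsHilbertSchmidt T) : ‖T‖ ^ 2 ≤ hsNormSq T := by
  have h : ‖adjoint T‖ ≤ √(hsNormSq T) := by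
    refine opNorm_le_bound _ (Real.sqrt_nonneg _) fun x => ?_
    refine le_of_sq_le_sq ?_ (by positivity)
    rw [mul_pow, Real.sq_sqrt (hsNormSq_nonneg T)]
    exact hT.norm_adjoint_apply_sq_le x
  rw [LinearIsometryEquiv.norm_map] at h
  rw [← Real.sq_sqrt (hsNormSq_nonneg T)]
  exact pow_le_pow_left₀ (norm_nonneg _) h 2

theorem IsHilbertSchmidt.sub {T V : L2Seq 𝕜 →L[𝕜] L2Seq 𝕜}
    (hT : IsHilbertSchmidt T) (hV : IsHilbertSchmidt V) : IsHilbertSchmidt (T - V) := by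
  refine Summable.of_nonneg_of_le (fun i => sq_nonneg _) (fun i => ?_)
    ((hT.mul_left 2).add (hV.mul_left 2))
  have := norm_sub_le (T (stdVec 𝕜 i)) (V (stdVec 𝕜 i))
  rw [sub_apply]
  nlinarith [sq_nonneg (‖T (stdVec 𝕜 i)‖ - ‖V (stdVec 𝕜 i)‖),
    norm_nonneg (T (stdVec 𝕜 i) - V (stdVec 𝕜 i))]

theorem ext_stdVec {T V : L2Seq 𝕜 →L[𝕜] L2Seq 𝕜}
    (h : ∀ i, T (stdVec 𝕜 i) = V (stdVec 𝕜 i)) : T = V := by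
  have : adjoint T = adjoint V := by
    ext x i
    rw [coord_adjoint, coord_adjoint, adjoint_adjoint, adjoint_adjoint, h]
  exact adjoint.injective this

theorem IsHilbertSchmidt.eq_zero {T : L2Seq 𝕜 →L[𝕜] L2Seq 𝕜}
    (hT : IsHilbertSchmidt T) (h : hsNormSq T = 0) : T = 0 := by
  have h1 := hT.norm_sq_le
  rw [h] at h1
  exact norm_eq_zero.1 (by nlinarith [norm_nonneg T])

/-- `‖Te‖ = ‖|T|e‖`, and `‖|T|e‖²` is at most a constant times `⟨|T|e, e⟩`. -/
theorem IsTraceClass.isHilbertSchmidt {T : L2Seq 𝕜 →L[𝕜] L2Seq 𝕜} (hT : IsTraceClass T) :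
    IsHilbertSchmidt T := by
  obtain ⟨A, ⟨hA, hAT⟩, hs⟩ := hT
  have hs' := RCLike.hasSum_re 𝕜 hs.hasSum |>.summable
  refine Summable.of_nonneg_of_le (fun i => sq_nonneg _) (fun i => ?_) (hs'.mul_left (‖A‖ + 1))
  set e := stdVec 𝕜 i with he
  have h1 : ‖T e‖ ^ 2 = ‖A e‖ ^ 2 := by
    rw [← inner_self_eq_norm_sq (𝕜 := 𝕜), ← inner_self_eq_norm_sq (𝕜 := 𝕜),
      ← adjoint_inner_right, hA.isSelfAdjoint.inner_apply_left, ← mul_apply_eq_comp,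
      ← mul_apply_eq_comp, hAT]
  rw [h1]
  have h2 := hA.norm_apply_sq_le e
  rwa [hA.isSelfAdjoint.inner_apply_left] at h2

theorem diagEntry_adjoint_mul (T V : L2Seq 𝕜 →L[𝕜] L2Seq 𝕜) (i : ℕ) :
    diagEntry (adjoint T * V) i = inner 𝕜 (T (stdVec 𝕜 i)) (V (stdVec 𝕜 i)) := by
  rw [diagEntry, mul_apply_eq_comp, adjoint_inner_right]

theorem IsHilbertSchmidt.summable_diagEntry {T V : L2Seq 𝕜 →L[𝕜] L2Seq 𝕜}
    (hT : IsHilbertSchmidt T) (hV : IsHilbertSchmidt V) :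
    Summable (diagEntry (adjoint T * V)) := by
  refine Summable.of_norm_bounded (hT.add hV) fun i => ?_
  rw [diagEntry_adjoint_mul]
  have := norm_inner_le_norm (𝕜 := 𝕜) (T (stdVec 𝕜 i)) (V (stdVec 𝕜 i))
  nlinarith [sq_nonneg (‖T (stdVec 𝕜 i)‖ - ‖V (stdVec 𝕜 i)‖), sq_nonneg ‖T (stdVec 𝕜 i)‖,
    sq_nonneg ‖V (stdVec 𝕜 i)‖]

theorem IsHilbertSchmidt.hasSum_re_inner {T V : L2Seq 𝕜 →L[𝕜] L2Seq 𝕜}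
    (hT : IsHilbertSchmidt T) (hV : IsHilbertSchmidt V) :
    HasSum (fun i => RCLike.re (inner 𝕜 (T (stdVec 𝕜 i)) (V (stdVec 𝕜 i))))
      (RCLike.re (opTrace (adjoint T * V))) := by
  simp only [← diagEntry_adjoint_mul]
  exact RCLike.hasSum_re 𝕜 (hT.summable_diagEntry hV).hasSum

theorem IsHilbertSchmidt.hsNormSq_eq {T : L2Seq 𝕜 →L[𝕜] L2Seq 𝕜} (hT : IsHilbertSchmidt T) :
    hsNormSq T = RCLike.re (opTrace (adjoint T * T)) := by
  rw [← (hT.hasSum_re_inner hT).tsum_eq, hsNormSq]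
  simp only [inner_self_eq_norm_sq (𝕜 := 𝕜)]

theorem IsHilbertSchmidt.hsNormSq_sub {T V : L2Seq 𝕜 →L[𝕜] L2Seq 𝕜}
    (hT : IsHilbertSchmidt T) (hV : IsHilbertSchmidt V) :
    hsNormSq (T - V) = RCLike.re (opTrace (adjoint T * T))
      - 2 * RCLike.re (opTrace (adjoint T * V)) + RCLike.re (opTrace (adjoint V * V)) := by
  refine HasSum.tsum_eq ?_
  have h : ∀ i, ‖(T - V) (stdVec 𝕜 i)‖ ^ 2 =
      RCLike.re (inner 𝕜 (T (stdVec 𝕜 i)) (T (stdVec 𝕜 i)))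
        - 2 * RCLike.re (inner 𝕜 (T (stdVec 𝕜 i)) (V (stdVec 𝕜 i)))
        + RCLike.re (inner 𝕜 (V (stdVec 𝕜 i)) (V (stdVec 𝕜 i))) := fun i => by
    rw [sub_apply, @norm_sub_sq 𝕜, inner_self_eq_norm_sq (𝕜 := 𝕜), inner_self_eq_norm_sq (𝕜 := 𝕜)]
  simp only [h]
  exact ((hT.hasSum_re_inner hT).sub ((hT.hasSum_re_inner hV).mul_left 2)).add
    (hV.hasSum_re_inner hV)

/-! ### Finitely many Hilbert-Schmidt norms of powers force a projection. -/

/-- A positive operator, the powers of which are Hilbert-Schmidt with finitely many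
Hilbert-Schmidt norms, is a projection. -/
theorem ContinuousLinearMap.IsPositive.isStarProjection_of_finite_hsNormSq
    {A : L2Seq 𝕜 →L[𝕜] L2Seq 𝕜} (hA : A.IsPositive)
    (hs : ∀ n : ℕ, IsHilbertSchmidt (A ^ (n + 1)))
    (hfin : (Set.range fun n : ℕ => hsNormSq (A ^ (n + 1))).Finite) : IsStarProjection A := by
  have hsa := hA.isSelfAdjoint
  have hA1 : ‖A‖ ≤ 1 := by
    by_contra! h
    obtain ⟨C, hC⟩ := hfin.bddAbove
    -- Exceeding both `C` and `1` makes the square of the norm exceed `C` too. Exponents `2 ^ m` are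
    -- used because there `‖A ^ k‖ = ‖A‖ ^ k` follows from the C*-identity.
    obtain ⟨n, hn⟩ := pow_unbounded_of_one_lt (max C 1) h
    obtain ⟨m, hm⟩ : ∃ m, n ≤ 2 ^ m := ⟨n, Nat.lt_two_pow_self.le⟩
    have h1 : ‖A ^ (2 ^ m)‖ = ‖A‖ ^ (2 ^ m) := by
      have := IsSelfAdjoint.nnnorm_pow_two_pow (E := L2Seq 𝕜 →L[𝕜] L2Seq 𝕜) hsa m
      exact congrArg NNReal.toReal this
    have h2 : max C 1 < ‖A ^ (2 ^ m)‖ := by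
      rw [h1]; exact hn.trans_le (pow_le_pow_right₀ h.le hm)
    have h3 : 2 ^ m - 1 + 1 = 2 ^ m := Nat.sub_add_cancel Nat.one_le_two_pow
    have h4 := (hs (2 ^ m - 1)).norm_sq_le
    have h5 : hsNormSq (A ^ (2 ^ m - 1 + 1)) ≤ C := hC ⟨_, rfl⟩
    rw [h3] at h4 h5
    nlinarith [le_max_left C 1, le_max_right C 1]
  have hstep : ∀ n i, ‖(A ^ (n + 1)) (stdVec 𝕜 i)‖ ≤ ‖(A ^ n) (stdVec 𝕜 i)‖ := by
    intro n i
    rw [pow_succ', mul_apply_eq_comp]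
    simpa using A.le_of_opNorm_le hA1 ((A ^ n) (stdVec 𝕜 i))
  have hanti : ∀ i, Antitone fun n => ‖(A ^ n) (stdVec 𝕜 i)‖ := fun i =>
    antitone_nat_of_succ_le fun n => hstep n i
  obtain ⟨m, n, hmn, heq⟩ : ∃ m n : ℕ, m < n ∧
      hsNormSq (A ^ (m + 1)) = hsNormSq (A ^ (n + 1)) := by
    have : ¬ Function.Injective fun n : ℕ => hsNormSq (A ^ (n + 1)) := fun hinj =>
      Set.infinite_range_of_injective hinj hfin
    simp only [Function.Injective, not_forall] at this
    obtain ⟨a, b, hab, hne⟩ := this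
    rcases lt_or_gt_of_ne hne with h | h
    · exact ⟨a, b, h, hab⟩
    · exact ⟨b, a, h, hab.symm⟩
  -- Two convergent series with equal sums, one dominating the other termwise, agree termwise.
  have hpt : ∀ i, ‖(A ^ (n + 1)) (stdVec 𝕜 i)‖ ^ 2 = ‖(A ^ (m + 1)) (stdVec 𝕜 i)‖ ^ 2 := by
    have hle : ∀ i, ‖(A ^ (n + 1)) (stdVec 𝕜 i)‖ ^ 2 ≤ ‖(A ^ (m + 1)) (stdVec 𝕜 i)‖ ^ 2 :=
      fun i => pow_le_pow_left₀ (norm_nonneg _) (hanti i (by omega)) 2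
    by_contra! h
    obtain ⟨i, hi⟩ := h
    exact (Summable.tsum_lt_tsum hle (lt_of_le_of_ne (hle i) hi) (hs n) (hs m)).ne heq.symm
  have hid : A * A = A := ext_stdVec fun i => by
    refine hA.apply_apply_eq hA1 m (le_antisymm (hstep _ i) ?_)
    have h1 : ‖(A ^ (n + 1)) (stdVec 𝕜 i)‖ ≤ ‖(A ^ (m + 2)) (stdVec 𝕜 i)‖ :=
      hanti i (by omega)
    rwa [(pow_left_inj₀ (norm_nonneg _) (norm_nonneg _) two_ne_zero).1 (hpt i)] at h1
  exact ⟨hid, hsa⟩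

/-! ### Total boundedness from prescribed row and column norms. -/

theorem tsum_le_sum_add_tsum_tail {f g : ℕ → ℝ} (hf : Summable f) (hg : Summable g)
    (hfg : ∀ i, f i ≤ g i) {n : ℕ} {c : ℝ} (hc : ∀ i < n, f i ≤ c) :
    ∑' i, f i ≤ n * c + ∑' i, g (i + n) := by
  rw [← hf.sum_add_tsum_nat_add n]
  refine add_le_add ?_ (Summable.tsum_le_tsum (fun i => hfg (i + n))
    ((summable_nat_add_iff n).2 hf) ((summable_nat_add_iff n).2 hg))
  refine (Finset.sum_le_card_nsmul _ _ c fun i hi => hc i (Finset.mem_range.1 hi)).trans ?_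
  simp

/-- The Hilbert-Schmidt norm is controlled by finitely many matrix entries and by the norms of the
remaining rows and columns. -/
theorem hsNormSq_le_of_tails {D : L2Seq 𝕜 →L[𝕜] L2Seq 𝕜} {a b : ℕ → ℝ}
    (ha : Summable a) (hb : Summable b) (hDa : ∀ j, ‖D (stdVec 𝕜 j)‖ ^ 2 ≤ a j)
    (hDb : ∀ i, ‖adjoint D (stdVec 𝕜 i)‖ ^ 2 ≤ b i) {N M : ℕ} {η : ℝ}
    (hη : ∀ j < N, ∀ i < M, ‖D (stdVec 𝕜 j) i‖ ≤ η) :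
    hsNormSq D ≤ N * (M * η ^ 2 + ∑' i, b (i + M)) + ∑' j, a (j + N) := by
  refine tsum_le_sum_add_tsum_tail (Summable.of_nonneg_of_le (fun _ => sq_nonneg _) hDa ha) ha hDa
    fun j hj => ?_
  have hs := L2Seq.hasSum_norm_sq (D (stdVec 𝕜 j))
  rw [← hs.tsum_eq]
  refine tsum_le_sum_add_tsum_tail hs.summable hb (fun i => ?_) fun i hi =>
    pow_le_pow_left₀ (norm_nonneg _) (hη j hj i hi) 2
  have h1 := norm_coord_le D i (stdVec 𝕜 j)
  rw [norm_stdVec, mul_one] at h1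
  exact (pow_le_pow_left₀ (norm_nonneg _) h1 2).trans (hDb i)

/-- If the norms of the rows and columns are fixed and square-summable on a set of operators that
is uniformly separated in the Hilbert-Schmidt norm, then the set is finite. -/
theorem finite_of_hsNormSq_separated {X : Set (L2Seq 𝕜 →L[𝕜] L2Seq 𝕜)}
    {a b : ℕ → ℝ} (ha : Summable a) (hb : Summable b)
    (hXa : ∀ T ∈ X, ∀ i, ‖T (stdVec 𝕜 i)‖ ^ 2 = a i)
    (hXb : ∀ T ∈ X, ∀ i, ‖adjoint T (stdVec 𝕜 i)‖ ^ 2 = b i)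
    {δ : ℝ} (hδ : 0 < δ) (hsep : ∀ T ∈ X, ∀ V ∈ X, hsNormSq (T - V) < δ → T = V) :
    X.Finite := by
  have hle : ∀ {u v : L2Seq 𝕜} {c : ℝ}, ‖u‖ ^ 2 = c → ‖v‖ ^ 2 = c → ‖u - v‖ ^ 2 ≤ 4 * c := by
    intro u v c hu hv
    nlinarith [norm_sub_le u v, norm_nonneg (u - v), norm_nonneg u, norm_nonneg v,
      sq_nonneg (‖u‖ - ‖v‖)]
  -- Differences cost a factor 4 on both tails, so the total is below `δ/16 + 4·δ/16 + 4·δ/16 < δ`.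
  -- The row tail is counted once for each of the `N` columns, so `M` is chosen after `N`.
  obtain ⟨N, hN⟩ : ∃ N : ℕ, ∑' j, a (j + N) < δ / 16 :=
    ((tendsto_sum_nat_add a).eventually (gt_mem_nhds (by positivity))).exists
  obtain ⟨M, hM⟩ : ∃ M : ℕ, ∑' i, b (i + M) < δ / 16 / (N + 1) :=
    ((tendsto_sum_nat_add b).eventually (gt_mem_nhds (by positivity))).exists
  obtain ⟨η, hη, hηle⟩ : ∃ η : ℝ, 0 < η ∧ N * (M * η ^ 2) ≤ δ / 16 := by
    refine ⟨√(δ / 16 / (N * M + 1)), Real.sqrt_pos.2 (by positivity), ?_⟩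
    rw [Real.sq_sqrt (by positivity), ← mul_assoc, mul_div_assoc', div_le_iff₀ (by positivity)]
    nlinarith
  -- The corner block lies in a finite-dimensional space, where bounded sets are totally bounded,
  -- and it determines an element of `X`.
  let F : (L2Seq 𝕜 →L[𝕜] L2Seq 𝕜) → Fin N → Fin M → 𝕜 := fun T j i => T (stdVec 𝕜 j) i
  have hclose : ∀ T ∈ X, ∀ V ∈ X, dist (F T) (F V) < η → T = V := by
    intro T hT V hV hd
    have hentry : ∀ j < N, ∀ i < M, ‖(T - V) (stdVec 𝕜 j) i‖ ≤ η := by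
      intro j hj i hi
      have h1 := (dist_le_pi_dist (F T ⟨j, hj⟩) (F V ⟨j, hj⟩) ⟨i, hi⟩).trans
        (dist_le_pi_dist (F T) (F V) ⟨j, hj⟩)
      rw [dist_eq_norm] at h1
      exact h1.trans hd.le
    apply hsep T hT V hV
    have h1 := hsNormSq_le_of_tails (ha.mul_left 4) (hb.mul_left 4)
      (fun j => by rw [sub_apply]; exact hle (hXa T hT j) (hXa V hV j))
      (fun i => by rw [map_sub, sub_apply]; exact hle (hXb T hT i) (hXb V hV i)) hentry
    rw [tsum_mul_left, tsum_mul_left] at h1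
    have h2 : (N : ℝ) * ∑' i, b (i + M) ≤ δ / 16 := by
      refine (mul_le_mul_of_nonneg_left hM.le (Nat.cast_nonneg N)).trans ?_
      rw [mul_div_assoc', div_le_iff₀ (by positivity)]
      nlinarith
    linarith
  have hbdd : F '' X ⊆ Metric.closedBall 0 √(∑' j, a j) := by
    rintro _ ⟨T, hT, rfl⟩
    have ha0 : ∀ j, 0 ≤ a j := fun j => hXa T hT j ▸ sq_nonneg _
    rw [mem_closedBall_zero_iff, pi_norm_le_iff_of_nonneg (Real.sqrt_nonneg _)]
    refine fun j => (pi_norm_le_iff_of_nonneg (Real.sqrt_nonneg _)).2 fun i => ?_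
    refine (lp.norm_apply_le_norm two_ne_zero _ _).trans (Real.le_sqrt_of_sq_le ?_)
    rw [hXa T hT j]
    exact ha.le_tsum _ fun k _ => ha0 k
  have htb : TotallyBounded (F '' X) :=
    (isCompact_closedBall _ _).totallyBounded.subset hbdd
  obtain ⟨t, htfin, ht⟩ := Metric.totallyBounded_iff.1 htb (η / 2) (half_pos hη)
  have hex : ∀ T ∈ X, ∃ y ∈ t, dist (F T) y < η / 2 := fun T hT => by
    simpa using ht ⟨T, hT, rfl⟩
  choose! g hgt hgd using hex
  refine Set.Finite.of_injOn (fun T hT => hgt T hT) (fun T hT V hV hTV => ?_) htfin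
  refine hclose T hT V hV ((dist_triangle_right _ _ (g T)).trans_lt ?_)
  have h1 := hgd T hT
  have h2 := hgd V hV
  rw [← hTV] at h2
  linarith

/-- The positive powers of an element of a subsemigroup belong to it. -/
theorem Subsemigroup.pow_succ_mem {M : Type*} [Monoid M] (S : Subsemigroup M) {x : M}
    (hx : x ∈ S) (n : ℕ) : x ^ (n + 1) ∈ S := by
  induction n with
  | zero => simpa using hx
  | succ k ih => rw [pow_succ]; exact S.mul_mem ih hx

theorem Set.Finite.exists_pos_le {s : Set ℝ} (hs : s.Finite) :
    ∃ δ > 0, ∀ x ∈ s, 0 < x → δ ≤ x := by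
  induction s, hs using Set.Finite.induction_on with
  | empty => exact ⟨1, one_pos, by simp⟩
  | @insert y s _ _ ih =>
    obtain ⟨δ, hδ, h⟩ := ih
    by_cases hy : 0 < y
    · refine ⟨min δ y, lt_min hδ hy, ?_⟩
      rintro x (rfl | hx) h0
      · exact min_le_right _ _
      · exact (min_le_left _ _).trans (h x hx h0)
    · refine ⟨δ, hδ, ?_⟩
      rintro x (rfl | hx) h0
      · exact absurd h0 hy
      · exact h x hx h0

end SequenceSpace

/-! ### The finiteness theorem. -/

theorem mainTheorem4 {𝕜 : Type*} [RCLike 𝕜]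
    (S : Subsemigroup (L2Seq 𝕜 →L[𝕜] L2Seq 𝕜))
    (hadj : ∀ T ∈ S, ContinuousLinearMap.adjoint T ∈ S)
    (htc : ∀ T ∈ S, IsTraceClass T)
    (htr : {t : 𝕜 | ∃ T ∈ S, opTrace T = t}.Finite)
    (hproj : {P : L2Seq 𝕜 →L[𝕜] L2Seq 𝕜 | P ∈ S ∧ IsStarProjection P}.Finite) :
    (S : Set (L2Seq 𝕜 →L[𝕜] L2Seq 𝕜)).Finite := by
  have hHS : ∀ T ∈ S, IsHilbertSchmidt T := fun T hT => (htc T hT).isHilbertSchmidt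
  have hmem : ∀ T ∈ S, ∀ V ∈ S, ContinuousLinearMap.adjoint T * V ∈ S := fun T hT V hV =>
    S.mul_mem (hadj T hT) hV
  set R : Set ℝ := RCLike.re '' {t : 𝕜 | ∃ T ∈ S, opTrace T = t}
  have hR : R.Finite := htr.image _
  have hRmem : ∀ T ∈ S, ∀ V ∈ S, RCLike.re (opTrace (ContinuousLinearMap.adjoint T * V)) ∈ R :=
    fun T hT V hV => ⟨_, ⟨_, hmem T hT V hV, rfl⟩, rfl⟩
  have hpr : ∀ T ∈ S, IsStarProjection (ContinuousLinearMap.adjoint T * T) := by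
    intro T hT
    have hpow : ∀ n, (ContinuousLinearMap.adjoint T * T) ^ (n + 1) ∈ S :=
      S.pow_succ_mem (hmem T hT T hT)
    have hpos : (ContinuousLinearMap.adjoint T * T).IsPositive :=
      ContinuousLinearMap.isPositive_adjoint_comp_self T
    refine hpos.isStarProjection_of_finite_hsNormSq
      (fun n => hHS _ (hpow n)) (hR.subset ?_)
    rintro _ ⟨n, rfl⟩
    simp only [(hHS _ (hpow n)).hsNormSq_eq]
    exact hRmem _ (hpow n) _ (hpow n)
  -- `δ` bounds from below the positive values among the finitely many candidates for `hsNormSq (T -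
  -- V)`.
  obtain ⟨δ, hδ, hδR⟩ :=
    (((hR.prod (hR.prod hR)).image fun p : ℝ × ℝ × ℝ => p.1 - 2 * p.2.1 + p.2.2)).exists_pos_le
  have hsep : ∀ T ∈ S, ∀ V ∈ S, hsNormSq (T - V) < δ → T = V := by
    intro T hT V hV hlt
    have h1 := hδR (hsNormSq (T - V)) ⟨(_, _, _), ⟨hRmem T hT T hT, hRmem T hT V hV,
      hRmem V hV V hV⟩, ((hHS T hT).hsNormSq_sub (hHS V hV)).symm⟩
    have h2 : hsNormSq (T - V) = 0 :=
      ((hsNormSq_nonneg _).eq_or_lt.resolve_right fun h => (h1 h).not_gt hlt).symm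
    exact sub_eq_zero.1 (((hHS T hT).sub (hHS V hV)).eq_zero h2)
  have hsq : ∀ (T : L2Seq 𝕜 →L[𝕜] L2Seq 𝕜) (i : ℕ), ‖T (stdVec 𝕜 i)‖ ^ 2 =
      RCLike.re (diagEntry (ContinuousLinearMap.adjoint T * T) i) := fun T i => by
    rw [diagEntry_adjoint_mul, inner_self_eq_norm_sq (𝕜 := 𝕜)]
  -- The second component is `TT*`, written so that `hpr` and `hsq` apply to `T*` verbatim.
  let Φ : (L2Seq 𝕜 →L[𝕜] L2Seq 𝕜) → (L2Seq 𝕜 →L[𝕜] L2Seq 𝕜) × (L2Seq 𝕜 →L[𝕜] L2Seq 𝕜) :=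
    fun T => (ContinuousLinearMap.adjoint T * T,
      ContinuousLinearMap.adjoint (ContinuousLinearMap.adjoint T) * ContinuousLinearMap.adjoint T)
  refine Set.Finite.of_finite_fibers Φ ((hproj.prod hproj).subset ?_) ?_
  · rintro _ ⟨T, hT, rfl⟩
    exact ⟨⟨hmem T hT T hT, hpr T hT⟩, ⟨hmem _ (hadj T hT) _ (hadj T hT), hpr _ (hadj T hT)⟩⟩
  · rintro _ ⟨T, hT, rfl⟩
    refine finite_of_hsNormSq_separated (hHS T hT) (hHS _ (hadj T hT)) ?_ ?_ hδ
      fun V hV W hW => hsep V hV.1 W hW.1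
    · rintro V ⟨-, hV⟩ i
      have h : Φ V = Φ T := hV
      rw [hsq, hsq]
      exact congrArg (fun p => RCLike.re (diagEntry p.1 i)) h
    · rintro V ⟨-, hV⟩ i
      have h : Φ V = Φ T := hV
      rw [hsq, hsq]
      exact congrArg (fun p => RCLike.re (diagEntry p.2 i)) h
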